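/- Let $(a_k)_{k\ge 0}$ be real numbers with $a_0=1$, let $m\in\mathbb{R}$, and consider the theory obtained from the free scalar field of mass $m$ on four-dimensional Minkowski space by the field diffeomorphism $F(\phi)=\sum_{k\ge0}a_k\phi^{k+1}$. Put $$d_r=r!\sum_{j=0}^{r}(j+1)(r-j+1)a_ja_{r-j},\qquad c_r=-m^2\,\frac{(r+2)!}{2}\sum_{j=0}^{r}a_ja_{r-j}.$$ Its Feynman rules are: an internal edge with momentum $q$ contributes $\dfrac{i}{q^2-m^2}$; a vertex of degree $N\ge3$ whose incident edges carry momenta $q_1,\dots,q_N$ contributes $i\,\dfrac{d_{N-2}}{2}(q_1^2+\cdots+q_N^2)+i\,c_{N-2}$; an external edge contributes $1$. Here $q^2$ is the Minkowski square. Let $n\ge1$ and let $p_1,\dots,p_n\in\mathbb{R}^{1,3}$ be on-shell, $p_i^2=m^2$, and such that $\bigl(\sum_{i\in S}p_i\bigr)^2\ne m^2$ for every $S\subseteq\{1,\dots,n\}$ with $|S|\ge2$ (so that all propagators below are defined). Let $b_n$ be the sum, over all trees hanging below an edge $e$ with exactly $n$ external legs, labelled $1,\dots,n$ and carrying the momenta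 $p_1,\dots,p_n$ (all vertices of degree at least $3$, vertices and internal edges unlabelled), of the product of the Feynman rules of $e$ and of all edges and vertices below $e$; an edge above exactly the legs in $S$ carries the momentum $\sum_{i\in S}p_i$. For $n=1$ the edge $e$ is itself the external leg, so $b_1=1$. Then for every $n\ge0$ $$b_{n+1}=\sum_{k=0}^{n}\frac{(n+k)!}{n!}\,B_{n,k}(-1!\,a_1,-2!\,a_2,-3!\,a_3,\dots),$$ where $$B_{n,k}(x_1,x_2,\dots)=\sum_{\substack{j_1+j_2+\cdots=k\\ j_1+2j_2+\cdots=n\\ j_i\ge 0}}\frac{n!}{j_1!\,j_2!\cdots}\prod_{i\ge1}\Bigl(\frac{x_i}{i!}\Bigr)^{j_i}$$ are the partial Bell polynomials. In particular, for a given sequence $(a_k)$, $b_{n+1}$ has the same value for all masses $m$ and all such momenta $p_1,\dots,p_{n+1}$. -/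

import Mathlib

noncomputable section

namespace FieldDiffeo

open scoped Nat

/-- Momenta in four-dimensional Minkowski space-time; component `0` is the energy. -/
abbrev Momentum : Type := Fin 4 → ℝ

/-- The Minkowski square `p² = (p⁰)² - (p¹)² - (p²)² - (p³)²`. -/
def minkowskiSq (q : Momentum) : ℝ := q 0 ^ 2 - ∑ i : Fin 3, q i.succ ^ 2

/-- The partial Bell polynomial `B_{n,k}(x₁, x₂, …)`, evaluated at the real sequence `x`
(the value `x 0` is not used): the sum runs over all multiplicities `j₁, …, jₙ ≥ 0` with
`∑ jᵢ = k` and `∑ i jᵢ = n`. -/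
def bell (n k : ℕ) (x : ℕ → ℝ) : ℝ :=
  ∑ j ∈ (Finset.piAntidiag (Finset.Icc 1 n) k).filter
      (fun j : ℕ → ℕ => ∑ i ∈ Finset.Icc 1 n, i * j i = n),
    (n ! : ℝ) / (∏ i ∈ Finset.Icc 1 n, ((j i)! : ℝ)) *
      ∏ i ∈ Finset.Icc 1 n, (x i / (i ! : ℝ)) ^ j i

/-- `d_n = n! ∑_{j=0}^{n} (j+1)(n-j+1) a_j a_{n-j}`. -/
def kineticCoeff (a : ℕ → ℝ) (n : ℕ) : ℝ :=
  (n ! : ℝ) * ∑ j ∈ Finset.range (n + 1),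
    ((j : ℝ) + 1) * ((n : ℝ) - (j : ℝ) + 1) * a j * a (n - j)

/-- `c_n = -m² (n+2)!/2 ∑_{j=0}^{n} a_j a_{n-j}`. -/
def massCoeff (a : ℕ → ℝ) (m : ℝ) (n : ℕ) : ℝ :=
  -m ^ 2 * (((n + 2)! : ℝ) / 2) * ∑ j ∈ Finset.range (n + 1), a j * a (n - j)

/-- Feynman rule of an internal edge carrying the momentum `q`: `i / (q² - m²)`. -/
def propagator (m : ℝ) (q : Momentum) : ℂ :=
  Complex.I / ((minkowskiSq q - m ^ 2 : ℝ) : ℂ)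

/-- Feynman rule of the kinematic vertex whose incident edges carry the momenta in `Q`
(so that its degree is `N = Q.card`): `i (d_{N-2}/2) (q₁² + ⋯ + q_N²)`. -/
def kineticVertex (a : ℕ → ℝ) (Q : Multiset Momentum) : ℂ :=
  Complex.I * ((kineticCoeff a (Q.card - 2) / 2 * (Q.map minkowskiSq).sum : ℝ) : ℂ)

/-- Feynman rule of the massive vertex of degree `N`: `i c_{N-2}`. -/
def massVertex (a : ℕ → ℝ) (m : ℝ) (N : ℕ) : ℂ :=
  Complex.I * ((massCoeff a m (N - 2) : ℝ) : ℂ)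

/-- The combined vertex: the sum of the kinematic and the massive vertex. -/
def vertexFactor (a : ℕ → ℝ) (m : ℝ) (Q : Multiset Momentum) : ℂ :=
  kineticVertex a Q + massVertex a m Q.card

/-- `Subtree S` is the type of trees hanging below an edge `e` whose external legs below `e` are
labelled bijectively by `S`, nothing else being labelled, all vertices having degree at least three.
Either `e` is itself the external leg `i` (`leaf i`), or `e` ends in a vertex with at least two
further edges (`node`); the sets of external legs below these further edges form a partition of `S`,
and below each of them hangs a tree of the same kind. As the blocks of a partition are nonempty and
distinct, the lower edges at a vertex are identified by their blocks, so that every tree with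
unordered branches occurs exactly once. -/
inductive Subtree {ι : Type} [DecidableEq ι] : Finset ι → Type
  | leaf (i : ι) : Subtree {i}
  | node {S : Finset ι} (P : Finpartition S) (hP : 2 ≤ P.parts.card)
      (child : ∀ A : P.parts, Subtree (A : Finset ι)) : Subtree S

/-- There are only finitely many trees with a given set of external legs. -/
instance Subtree.instFinite {ι : Type} [DecidableEq ι] (S : Finset ι) : Finite (Subtree S) := by
  induction S using Finset.strongInduction with
  | H S ih =>
    have hlt : ∀ (P : Finpartition S), 2 ≤ P.parts.card → ∀ A ∈ P.parts, A ⊂ S := by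
      intro P hP A hA
      refine (Finset.ssubset_iff_subset_ne).2 ⟨P.le hA, ?_⟩
      rintro rfl
      obtain ⟨B, hB, hne⟩ := Finset.exists_mem_ne (s := P.parts) (by omega) A
      obtain ⟨x, hx⟩ := P.nonempty_of_mem_parts hB
      exact hne (P.eq_of_mem_parts hB hA hx (P.le hB hx))
    let N := Σ P : {P : Finpartition S // 2 ≤ P.parts.card},
      ∀ A : P.1.parts, Subtree (A : Finset ι)
    let L := {i : ι // {i} = S}
    have hN : Finite N := by
      have : ∀ P : {P : Finpartition S // 2 ≤ P.parts.card},
          Finite (∀ A : P.1.parts, Subtree (A : Finset ι)) := by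
        intro P
        have : ∀ A : P.1.parts, Finite (Subtree (A : Finset ι)) :=
          fun A => ih _ (hlt P.1 P.2 A A.2)
        infer_instance
      infer_instance
    have hL : Finite L := by
      refine Finite.of_injective (β := S)
        (fun i => ⟨i.1, Finset.singleton_subset_iff.1 i.2.le⟩) ?_
      intro i j h
      exact Subtype.ext (by simpa using h)
    let g : L ⊕ N → Subtree S := fun x => match x with
      | .inl i => cast (congrArg Subtree i.2) (Subtree.leaf i.1)
      | .inr x => Subtree.node x.1.1 x.1.2 x.2
    refine Finite.of_surjective g ?_
    intro T
    cases T with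
    | leaf i => exact ⟨.inl ⟨i, rfl⟩, rfl⟩
    | node P hP child => exact ⟨.inr ⟨⟨P, hP⟩, child⟩, rfl⟩

instance Subtree.instFintype {ι : Type} [DecidableEq ι] (S : Finset ι) : Fintype (Subtree S) :=
  Fintype.ofFinite _

/-- The momentum through an edge above exactly the external legs in `S`, as fixed by momentum
conservation (all edges oriented the same way along the tree). -/
def edgeMomentum {ι : Type} (p : ι → Momentum) (S : Finset ι) : Momentum := ∑ i ∈ S, p i

/-- Momentum is conserved at each vertex. -/
theorem sum_edgeMomentum {ι : Type} [DecidableEq ι] (p : ι → Momentum) {S : Finset ι}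
    (P : Finpartition S) : ∑ A ∈ P.parts, edgeMomentum p A = edgeMomentum p S := by
  unfold edgeMomentum
  conv_rhs => rw [← P.biUnion_parts]
  exact (Finset.sum_biUnion P.supIndep.pairwiseDisjoint).symm

/-- The Feynman rules applied to a tree below an edge `e`, including `e` itself: the product of the
propagators of the internal edges and of the vertex factors; external edges contribute `1`. -/
def Subtree.weight {ι : Type} [DecidableEq ι] (a : ℕ → ℝ) (m : ℝ) (p : ι → Momentum) :
    {S : Finset ι} → Subtree S → ℂ
  | _, .leaf _ => 1
  | S, .node P _ child =>
      propagator m (edgeMomentum p S) *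
        vertexFactor a m (edgeMomentum p S ::ₘ P.parts.val.map (edgeMomentum p)) *
        ∏ A : P.parts, (child A).weight a m p

/-- `b_n`: the sum, over all trees with `n` labelled external legs with momenta `p₁, …, pₙ` below
an edge, of the result of the Feynman rules. -/
def b (a : ℕ → ℝ) (m : ℝ) {n : ℕ} (p : Fin n → Momentum) : ℂ :=
  ∑ T : Subtree (Finset.univ : Finset (Fin n)), T.weight a m p

/-- The external momenta are on the mass shell, and no internal edge is: a set of at least two
external legs never has total momentum on the mass shell, so that all propagators are defined. -/
structure IsAdmissible (m : ℝ) {n : ℕ} (p : Fin n → Momentum) : Prop where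
  onShell : ∀ i, minkowskiSq (p i) = m ^ 2
  offShell : ∀ S : Finset (Fin n), 2 ≤ S.card → minkowskiSq (edgeMomentum p S) ≠ m ^ 2

end FieldDiffeo

end

/-! Let `G` be the compositional inverse of `F`. The tree sums are the Taylor coefficients of `G`: a
set `S` of legs contributes `g_S`, the `S.card`-th coefficient of `G` as an exponential generating
function, whatever the mass and momenta. Cutting a tree at its top vertex gives a recursion over
partitions of `S` with at least two blocks. A one-block partition would be a bivalent vertex with
factor `q² - m²`, the inverse propagator up to `i`. Hence `g_S` solves the recursion exactly when
the vertex factors weighted by `∏ g_A`, summed over all partitions, cancel (`sum_vertex_eq_zero`).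
For the cancellation, expand the squared momenta into products `p_i · p_j`. The exponential formula
turns each coefficient into one of a composition with `G`. Since `F(G) = t` and `F'(G) G' = 1`, all
of these reduce to one number `W`, the coefficient of `F'(G)` of index `S.card - 1`: the kinetic sum
is `W`, restricting it to `i ≠ j` in a common block gives `-W`, and the mass sum is `-m² |S| W`. On
the mass shell the total is zero. Lagrange inversion for `F = t A`, with `A⁻¹ ^ (n + 1)` expanded in
powers of `1 - A`, then produces the Bell polynomials. -/

namespace FieldDiffeo
open PowerSeries
open scoped Nat PowerSeries

/-! ### Exponential generating functions. -/

/-- The `n`-th coefficient of a power series, read as an exponential generating function. -/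
noncomputable def egfCoeff (n : ℕ) (f : ℝ⟦X⟧) : ℝ := (n ! : ℝ) * coeff n f

theorem egfCoeff_succ (n : ℕ) (f : ℝ⟦X⟧) : egfCoeff (n + 1) f = egfCoeff n (d⁄dX ℝ f) := by
  simp only [egfCoeff, coeff_derivative, Nat.factorial_succ]
  push_cast
  ring

theorem constantCoeff_subst_of_constantCoeff_eq_zero {G : ℝ⟦X⟧} (hG : constantCoeff G = 0)
    (f : ℝ⟦X⟧) : constantCoeff (f.subst G) = constantCoeff f := by
  rw [← coeff_zero_eq_constantCoeff_apply, coeff_subst' (HasSubst.of_constantCoeff_zero' hG),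
    finsum_eq_single _ 0]
  · simp
  · intro k hk
    simp [hG, hk]

theorem egfCoeff_X_mul (n : ℕ) (f : ℝ⟦X⟧) :
    egfCoeff (n + 1) (X * f) = (n + 1) * egfCoeff n f := by
  simp only [egfCoeff, coeff_succ_X_mul, Nat.factorial_succ]
  push_cast
  ring

/-- A product of exponential generating functions counts the ways to split a set in two; the
binomial coefficient is the number of subsets of a given size. -/
theorem sum_powerset_egfCoeff_mul {ι : Type*} [DecidableEq ι] (S : Finset ι) (f g : ℝ⟦X⟧) :
    ∑ U ∈ S.powerset, egfCoeff U.card f * egfCoeff (S \ U).card g = egfCoeff S.card (f * g) := by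
  have h : ∀ U ∈ S.powerset, egfCoeff U.card f * egfCoeff (S \ U).card g =
      (fun k => egfCoeff k f * egfCoeff (S.card - k) g) U.card := by
    intro U hU
    simp only [Finset.card_sdiff_of_subset (Finset.mem_powerset.1 hU)]
  rw [Finset.sum_congr rfl h,
    Finset.sum_powerset_apply_card (fun k => egfCoeff k f * egfCoeff (S.card - k) g), egfCoeff, coeff_mul,
    Finset.Nat.sum_antidiagonal_eq_sum_range_succ (fun i j => coeff i f * coeff j g),
    Finset.mul_sum]
  refine Finset.sum_congr rfl fun k hk => ?_
  have hk' : k ≤ S.card := Nat.lt_succ_iff.1 (Finset.mem_range.1 hk)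
  rw [nsmul_eq_mul, ← Nat.choose_mul_factorial_mul_factorial hk']
  simp only [egfCoeff]
  push_cast
  ring

/-! ### The diffeomorphism series and Lagrange inversion. -/

/-- The field diffeomorphism `F(t) = ∑ aₖ tᵏ⁺¹` as a formal power series. -/
noncomputable def diffeo (a : ℕ → ℝ) : ℝ⟦X⟧ := X * mk a

theorem constantCoeff_diffeo (a : ℕ → ℝ) : constantCoeff (diffeo a) = 0 := by
  simp [diffeo]

theorem isUnit_coeff_one_diffeo {a : ℕ → ℝ} (ha : a 0 = 1) : IsUnit (coeff 1 (diffeo a)) := by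
  have : coeff 1 (diffeo a) = 1 := by
    rw [diffeo, coeff_succ_X_mul, coeff_mk, ha]
  simp [this]

/-- The power series `F'(F⁻¹(t))`, the inverse of the derivative of `F⁻¹`. -/
noncomputable def derivAlong (a : ℕ → ℝ) (G : ℝ⟦X⟧) : ℝ⟦X⟧ := (d⁄dX ℝ (diffeo a)).subst G

theorem derivAlong_mul_derivative {a : ℕ → ℝ} {G : ℝ⟦X⟧} (hG : HasSubst G)
    (h : (diffeo a).subst G = X) : derivAlong a G * d⁄dX ℝ G = 1 := by
  have := congrArg (d⁄dX ℝ) h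
  rwa [derivative_subst hG, derivative_X] at this

/-- With `u = t A`, this is the residue of `u' / u ^ (j + 2)`, which vanishes because the form is
exact. The proof avoids Laurent series: the operator `(j + 1) - t d/dt` kills the coefficient of `t
^ (j + 1)`. -/
theorem coeff_succ_derivative_mul_inv_pow {A : ℝ⟦X⟧} (hA : constantCoeff A ≠ 0) (j : ℕ) :
    coeff (j + 1) (d⁄dX ℝ (X * A) * A⁻¹ ^ (j + 2)) = 0 := by
  have hAi : A * A⁻¹ = 1 := PowerSeries.mul_inv_cancel A hA
  have key : ((j : ℝ) + 1) • (d⁄dX ℝ (X * A) * A⁻¹ ^ (j + 2)) =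
      ((j : ℝ) + 1) • A⁻¹ ^ (j + 1) - X * d⁄dX ℝ (A⁻¹ ^ (j + 1)) := by
    rw [derivative_pow, Derivation.leibniz, derivative_X, derivative_inv']
    simp only [smul_eq_mul, PowerSeries.smul_eq_C_mul, Nat.add_sub_cancel]
    have hc : (C ((j : ℝ) + 1) : ℝ⟦X⟧) = (j : ℝ⟦X⟧) + 1 := by simp
    rw [hc]
    push_cast
    linear_combination ((j : ℝ⟦X⟧) + 1) * A⁻¹ ^ (j + 1) * hAi
  have h2 := congrArg (coeff (j + 1)) key
  simp only [map_sub, coeff_succ_X_mul, coeff_derivative, PowerSeries.coeff_smul,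
    smul_eq_mul] at h2
  have hj : ((j : ℝ) + 1) ≠ 0 := by positivity
  refine (mul_eq_zero.1 (h2.trans ?_)).resolve_left hj
  ring

/-- Invariance of the residue of `Q(u) / u ^ (n + 1) du` under the substitution `u = t A`. By
linearity it suffices to treat monomials `u ^ k` with `k ≤ n`. -/
theorem coeff_subst_mul_derivative_mul_inv_pow {A : ℝ⟦X⟧} (hA : constantCoeff A ≠ 0)
    (Q : ℝ⟦X⟧) (n : ℕ) :
    coeff n (Q.subst (X * A) * d⁄dX ℝ (X * A) * A⁻¹ ^ (n + 1)) = coeff n Q := by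
  have hs : HasSubst (X * A) := HasSubst.of_constantCoeff_zero' (by simp)
  have hAi : A * A⁻¹ = 1 := PowerSeries.mul_inv_cancel A hA
  have hmono : ∀ k ≤ n, coeff n ((X * A) ^ k * d⁄dX ℝ (X * A) * A⁻¹ ^ (n + 1)) =
      if k = n then 1 else 0 := by
    intro k hk
    obtain ⟨j, rfl⟩ := Nat.exists_eq_add_of_le hk
    have e : (X * A) ^ k * d⁄dX ℝ (X * A) * A⁻¹ ^ (k + j + 1) =
        X ^ k * (d⁄dX ℝ (X * A) * A⁻¹ ^ (j + 1)) := by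
      have : A ^ k * A⁻¹ ^ k = 1 := by rw [← mul_pow, hAi, one_pow]
      rw [mul_pow]
      linear_combination X ^ k * d⁄dX ℝ (X * A) * A⁻¹ ^ (j + 1) * this
    rw [e, add_comm k j, coeff_X_pow_mul]
    cases j with
    | zero =>
      have : constantCoeff A * (constantCoeff A)⁻¹ = 1 := mul_inv_cancel₀ hA
      simpa [Derivation.leibniz] using this
    | succ j =>
      rw [coeff_succ_derivative_mul_inv_pow hA, if_neg (by omega)]
  -- The tail of `Q` is divisible by `X ^ (n + 1)`, and stays so after substitution, so it does not
  -- reach the coefficient of index `n`.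
  have hQ : Q = ((trunc (n + 1) Q : Polynomial ℝ) : ℝ⟦X⟧) +
      X ^ (n + 1) * mk fun i => coeff (i + (n + 1)) Q :=
    (eq_X_pow_mul_shift_add_trunc (n + 1) Q).trans (add_comm _ _)
  have hsub : Q.subst (X * A) = ∑ k ∈ Finset.range (n + 1), C (coeff k Q) * (X * A) ^ k +
      (X * A) ^ (n + 1) * (mk fun i => coeff (i + (n + 1)) Q).subst (X * A) := by
    conv_lhs => rw [hQ]
    rw [subst_add hs, subst_mul hs, subst_pow hs, subst_X hs, subst_coe hs]
    congr 1
    rw [Polynomial.aeval_eq_sum_range' (n := n + 1) (natDegree_trunc_lt Q n)]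
    refine Finset.sum_congr rfl fun k hk => ?_
    rw [coeff_trunc, if_pos (Finset.mem_range.1 hk), PowerSeries.smul_eq_C_mul]
  have hz : coeff n ((X * A) ^ (n + 1) * (mk fun i => coeff (i + (n + 1)) Q).subst (X * A) *
      d⁄dX ℝ (X * A) * A⁻¹ ^ (n + 1)) = 0 := by
    rw [mul_pow, mul_assoc, mul_assoc, mul_assoc, coeff_X_pow_mul', if_neg (by omega)]
  rw [hsub, add_mul, add_mul, map_add, hz, add_zero, Finset.sum_mul, Finset.sum_mul, map_sum,
    Finset.sum_congr rfl (g := fun k => if k = n then coeff k Q else 0)]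
  · simp
  · intro k hk
    rw [mul_assoc, mul_assoc, coeff_C_mul, ← mul_assoc,
      hmono k (Nat.lt_succ_iff.1 (Finset.mem_range.1 hk))]
    simp

/-- **Lagrange inversion** for the compositional inverse `G` of `t A(t)`. -/
theorem coeff_succ_inverse {A G : ℝ⟦X⟧} (hA : constantCoeff A ≠ 0) (hG : G.subst (X * A) = X)
    (n : ℕ) : ((n : ℝ) + 1) * coeff (n + 1) G = coeff n (A⁻¹ ^ (n + 1)) := by
  have hs : HasSubst (X * A) := HasSubst.of_constantCoeff_zero' (by simp)
  have h1 : (d⁄dX ℝ G).subst (X * A) * d⁄dX ℝ (X * A) = 1 := by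
    have := congrArg (d⁄dX ℝ) hG
    rwa [derivative_subst hs, derivative_X] at this
  have h2 := coeff_subst_mul_derivative_mul_inv_pow hA (d⁄dX ℝ G) n
  rw [h1, one_mul, coeff_derivative] at h2
  rw [h2, mul_comm]

/-- The binomial series of `(1 - X) ^ (-(n + 1))` evaluated at `X = 1 - A`. It stops at `k = n`
because `(1 - A) ^ k` has order at least `k`. -/
theorem coeff_inv_pow {A : ℝ⟦X⟧} (hA : constantCoeff A = 1) (n : ℕ) :
    coeff n (A⁻¹ ^ (n + 1)) =
      ∑ k ∈ Finset.range (n + 1), ((n + k).choose n : ℝ) * coeff n ((1 - A) ^ k) := by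
  have h0 : constantCoeff (1 - A) = 0 := by simp [hA]
  have hs : HasSubst (1 - A) := HasSubst.of_constantCoeff_zero' h0
  have hAi : A * A⁻¹ = 1 := PowerSeries.mul_inv_cancel A (by simp [hA])
  have h1 : (mk fun k => ((n + k).choose n : ℝ)) * (1 - X) ^ (n + 1) = 1 := by
    rw [← mk_one_pow_eq_mk_choose_add, ← mul_pow, mk_one_mul_one_sub_eq_one, one_pow]
  have h2 : (mk fun k => ((n + k).choose n : ℝ)).subst (1 - A) * A ^ (n + 1) = 1 := by
    have := congrArg (fun f : ℝ⟦X⟧ => f.subst (1 - A)) h1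
    simp only [subst_mul hs, subst_pow hs, subst_sub hs, subst_X hs] at this
    have hone : (1 : ℝ⟦X⟧).subst (1 - A) = (1 : ℝ⟦X⟧) := by
      rw [← coe_substAlgHom hs, map_one]
    rw [hone, sub_sub_cancel] at this
    exact this
  have h3 : A⁻¹ ^ (n + 1) = (mk fun k => ((n + k).choose n : ℝ)).subst (1 - A) := by
    have : A ^ (n + 1) * A⁻¹ ^ (n + 1) = 1 := by rw [← mul_pow, hAi, one_pow]
    linear_combination (-A⁻¹ ^ (n + 1)) * h2 +
      (mk fun k => ((n + k).choose n : ℝ)).subst (1 - A) * this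
  rw [h3, coeff_subst' hs, finsum_eq_sum_of_support_subset (s := Finset.range (n + 1))]
  · simp
  · intro k hk
    simp only [Function.mem_support] at hk
    by_contra hkn
    apply hk
    have hkn' : n < k := by simpa using hkn
    refine smul_eq_zero_of_right _ (coeff_of_lt_order _ ?_)
    refine lt_of_lt_of_le (Nat.cast_lt.2 hkn') (le_order_pow_of_constantCoeff_eq_zero k h0)

/-! ### Bell polynomials as coefficients of powers. -/

theorem bell_eq_coeff (n k : ℕ) (x : ℕ → ℝ) :
    bell n k x = (n ! : ℝ) / (k ! : ℝ) *
      coeff n ((∑ i ∈ Finset.Icc 1 n, C (x i / (i ! : ℝ)) * X ^ i : ℝ⟦X⟧) ^ k) := by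
  rw [Finset.sum_pow_eq_sum_piAntidiag, map_sum, Finset.mul_sum, bell, Finset.sum_filter]
  refine Finset.sum_congr rfl fun j hj => ?_
  have hsum := (Finset.mem_piAntidiag.1 hj).1
  have hprod : (∏ i ∈ Finset.Icc 1 n, (C (x i / (i ! : ℝ)) * X ^ i : ℝ⟦X⟧) ^ j i) =
      C (∏ i ∈ Finset.Icc 1 n, (x i / (i ! : ℝ)) ^ j i) * X ^ (∑ i ∈ Finset.Icc 1 n, i * j i) := by
    simp only [mul_pow, Finset.prod_mul_distrib, map_prod, map_pow, ← pow_mul,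
      Finset.prod_pow_eq_pow_sum]
  have hm : ((Nat.multinomial (Finset.Icc 1 n) j : ℕ) : ℝ) =
      (k ! : ℝ) / ∏ i ∈ Finset.Icc 1 n, ((j i)! : ℝ) := by
    have h := Nat.multinomial_spec (Finset.Icc 1 n) j
    rw [hsum] at h
    rw [eq_div_iff (by positivity), mul_comm]
    exact_mod_cast h
  have hc : ((Nat.multinomial (Finset.Icc 1 n) j : ℕ) : ℝ⟦X⟧) =
      C ((Nat.multinomial (Finset.Icc 1 n) j : ℕ) : ℝ) := by simp
  rw [hprod, hc, coeff_C_mul, coeff_C_mul, coeff_X_pow, hm]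
  have hk : (k ! : ℝ) ≠ 0 := by positivity
  by_cases h : ∑ i ∈ Finset.Icc 1 n, i * j i = n
  · rw [if_pos h, if_pos h.symm]
    field_simp
  · rw [if_neg h, if_neg fun h' => h h'.symm]
    ring

/-- The polynomial in `bell_eq_coeff` agrees with `1 - A` modulo `X ^ (n + 1)`; its missing constant
term matches because `a 0 = 1`. -/
theorem bell_factorial_mul {a : ℕ → ℝ} (ha : a 0 = 1) (n k : ℕ) :
    bell n k (fun j => -(j ! : ℝ) * a j) =
      (n ! : ℝ) / (k ! : ℝ) * coeff n ((1 - mk a : ℝ⟦X⟧) ^ k) := by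
  rw [bell_eq_coeff]
  congr 1
  rw [← sub_eq_zero, ← map_sub]
  set T : ℝ⟦X⟧ := ∑ i ∈ Finset.Icc 1 n, C (-(i ! : ℝ) * a i / (i ! : ℝ)) * X ^ i
  have hd : (X : ℝ⟦X⟧) ^ (n + 1) ∣ T - (1 - mk a) := by
    rw [X_pow_dvd_iff]
    intro l hl
    have hf : (l ! : ℝ) ≠ 0 := by positivity
    simp only [T, map_sub, map_sum, coeff_C_mul, coeff_X_pow, coeff_mk, coeff_one, mul_ite,
      mul_one, mul_zero]
    rw [Finset.sum_ite_eq]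
    rcases Nat.eq_zero_or_pos l with rfl | hl0
    · simp [ha]
    · rw [if_pos (Finset.mem_Icc.2 ⟨hl0, by omega⟩), if_neg (by omega)]
      field_simp
      ring
  exact X_pow_dvd_iff.1 (hd.trans (sub_dvd_pow_sub_pow _ _ k)) n (Nat.lt_succ_self n)

theorem egfCoeff_inverse_eq_sum_bell {a : ℕ → ℝ} (ha : a 0 = 1) {G : ℝ⟦X⟧}
    (hG : G.subst (diffeo a) = X) (n : ℕ) :
    egfCoeff (n + 1) G = ∑ k ∈ Finset.range (n + 1), ((n + k)! : ℝ) / (n ! : ℝ) *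
      bell n k (fun j => -(j ! : ℝ) * a j) := by
  have hA : constantCoeff (mk a : ℝ⟦X⟧) = 1 := by simp [ha]
  have h : egfCoeff (n + 1) G = (n ! : ℝ) * (((n : ℝ) + 1) * coeff (n + 1) G) := by
    rw [egfCoeff, Nat.factorial_succ]
    push_cast
    ring
  rw [h, coeff_succ_inverse (by simp [hA]) hG, coeff_inv_pow hA, Finset.mul_sum]
  refine Finset.sum_congr rfl fun k _ => ?_
  have hc : ((n + k).choose n : ℝ) * (n ! : ℝ) * (k ! : ℝ) = ((n + k)! : ℝ) := by
    rw [Nat.choose_symm_add]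
    exact_mod_cast Nat.add_choose_mul_factorial_mul_factorial n k
  rw [bell_factorial_mul ha, ← hc]
  have h1 : (n ! : ℝ) ≠ 0 := by positivity
  have h2 : (k ! : ℝ) ≠ 0 := by positivity
  field_simp

/-! ### Sums over set partitions and the exponential formula. -/

section Partitions

variable {ι : Type*} [DecidableEq ι]

/-- Partitions of `S ∪ {i}` are classified by the block `U ∪ {i}` of `i` and the induced
partition of `S \ U`. -/
theorem sum_finpartition_insert {M : Type*} [AddCommMonoid M] {S : Finset ι} {i : ι} (hi : i ∉ S)
    (f : Finset (Finset ι) → M) :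
    ∑ P : Finpartition (insert i S), f P.parts =
      ∑ U ∈ S.powerset, ∑ Q : Finpartition (S \ U), f (insert (insert i U) Q.parts) := by
  rw [← Finset.sum_fiberwise_of_maps_to (s := Finset.univ) (t := S.powerset)
    (g := fun P : Finpartition (insert i S) => (P.part i).erase i)]
  swap
  · intro P _
    rw [Finset.mem_powerset, ← Finset.subset_insert_iff]
    exact P.part_subset i
  refine Finset.sum_congr rfl fun U hU => ?_
  have hUS : U ⊆ S := Finset.mem_powerset.1 hU
  have hiU : i ∉ U := fun h => hi (hUS h)
  have hpart : ∀ P : Finpartition (insert i S), (P.part i).erase i = U →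
      insert i U ∈ P.parts := by
    rintro P rfl
    rw [Finset.insert_erase (P.mem_part_self.2 (Finset.mem_insert_self i S)), P.part_mem]
    exact Finset.mem_insert_self i S
  have hne : insert i U ≠ (⊥ : Finset ι) := Finset.insert_ne_empty i U
  have hdisj : Disjoint (S \ U) (insert i U) := by
    rw [Finset.disjoint_insert_right]
    exact ⟨fun h => hi (Finset.mem_sdiff.1 h).1, Finset.sdiff_disjoint⟩
  have hsup : (S \ U) ⊔ insert i U = insert i S := by
    rw [Finset.sup_eq_union, Finset.union_insert, Finset.sdiff_union_of_subset hUS]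
  have hrest : ∀ P : Finpartition (insert i S), insert i U ∈ P.parts →
      (P.parts.erase (insert i U)).sup id = S \ U := by
    intro P hP
    ext x
    simp only [Finset.mem_sup, Finset.mem_erase, id, Finset.mem_sdiff]
    constructor
    · rintro ⟨A, ⟨hne, hA⟩, hx⟩
      have hnot : x ∉ insert i U := fun h => hne (P.eq_of_mem_parts hA hP hx h)
      rw [Finset.mem_insert, not_or] at hnot
      exact ⟨(Finset.mem_insert.1 (P.le hA hx)).resolve_left hnot.1, hnot.2⟩
    · rintro ⟨hxS, hxU⟩
      obtain ⟨A, hA, hx⟩ := P.exists_mem (Finset.mem_insert_of_mem (b := i) hxS)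
      refine ⟨A, ⟨?_, hA⟩, hx⟩
      rintro rfl
      rcases Finset.mem_insert.1 hx with rfl | h
      · exact hi hxS
      · exact hxU h
  have hnot : ∀ Q : Finpartition (S \ U), insert i U ∉ Q.parts := by
    intro Q h
    exact hi (Finset.mem_sdiff.1 (Q.le h (Finset.mem_insert_self i U))).1
  refine Finset.sum_bij'
    (fun P hP => P.ofSubset (Finset.erase_subset (insert i U) P.parts)
      (hrest P (hpart P (Finset.mem_filter.1 hP).2)))
    (fun Q _ => Q.extend hne hdisj hsup) ?_ ?_ ?_ ?_ ?_
  · simp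
  · intro Q _
    simp only [Finset.mem_filter, Finset.mem_univ, true_and]
    rw [Finpartition.part_eq_of_mem _ (t := insert i U) (by simp [Finpartition.extend])
      (Finset.mem_insert_self i U), Finset.erase_insert hiU]
  · intro P hP
    ext1
    exact Finset.insert_erase (hpart P (Finset.mem_filter.1 hP).2)
  · intro Q _
    ext1
    exact Finset.erase_insert (hnot Q)
  · intro P hP
    congr 1
    exact (Finset.insert_erase (hpart P (Finset.mem_filter.1 hP).2)).symm

/-- The exponential formula: partitions of a set with a weight `f` depending on the number of
blocks and a weight for each block depending on its size are counted by a composition of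
exponential generating functions. -/
theorem sum_finpartition_eq_egfCoeff_subst {G : ℝ⟦X⟧} (hG : constantCoeff G = 0) (S : Finset ι)
    (f : ℕ → ℝ) :
    ∑ P : Finpartition S, f P.parts.card * ∏ A ∈ P.parts, egfCoeff A.card G =
      egfCoeff S.card ((mk fun k => f k / (k ! : ℝ)).subst G) := by
  have hs : HasSubst G := HasSubst.of_constantCoeff_zero' hG
  induction S using Finset.strongInduction generalizing f with
  | H S ih =>
  rcases S.eq_empty_or_nonempty with rfl | ⟨i, hi⟩
  · rw [Fintype.sum_eq_single (⊥ : Finpartition (∅ : Finset ι)) fun P hP =>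
      absurd (Subsingleton.elim (α := Finpartition (⊥ : Finset ι)) P ⊥) hP]
    simp [egfCoeff, constantCoeff_subst_of_constantCoeff_eq_zero hG]
  · obtain ⟨S, hiS, rfl⟩ : ∃ S' : Finset ι, i ∉ S' ∧ S = insert i S' :=
      ⟨S.erase i, Finset.notMem_erase i S, (Finset.insert_erase hi).symm⟩
    -- Differentiation marks the element `i`: its block contributes `G'`, and the remaining elements
    -- form a partition with one block fewer, which shifts `f`. This is why the induction
    -- generalizes `f`.
    have hder : d⁄dX ℝ ((mk fun k => f k / (k ! : ℝ)).subst G) =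
        d⁄dX ℝ G * (mk fun k => f (k + 1) / (k ! : ℝ)).subst G := by
      rw [derivative_subst hs, mul_comm]
      congr 2
      ext k
      simp only [coeff_derivative, coeff_mk, Nat.factorial_succ]
      push_cast
      field_simp
    rw [sum_finpartition_insert hiS (fun p => f p.card * ∏ A ∈ p, egfCoeff A.card G),
      Finset.card_insert_of_notMem hiS, egfCoeff_succ, hder, ← sum_powerset_egfCoeff_mul]
    refine Finset.sum_congr rfl fun U hU => ?_
    have hUS := Finset.mem_powerset.1 hU
    have hlt : S \ U ⊂ insert i S :=
      lt_of_le_of_lt Finset.sdiff_subset (Finset.ssubset_insert hiS)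
    rw [← ih (S \ U) hlt (fun k => f (k + 1)), Finset.mul_sum]
    refine Finset.sum_congr rfl fun Q _ => ?_
    have hnot : insert i U ∉ Q.parts := fun h =>
      hiS (Finset.mem_sdiff.1 (Q.le h (Finset.mem_insert_self i U))).1
    rw [Finset.card_insert_of_notMem hnot, Finset.prod_insert hnot,
      Finset.card_insert_of_notMem fun h => hiS (hUS h), egfCoeff_succ]
    ring

/-- The variant of the exponential formula in which two given elements lie in the same block. -/
theorem sum_finpartition_same_block {G : ℝ⟦X⟧} (hG : constantCoeff G = 0) {S : Finset ι}
    {i j : ι} (hj : j ∉ S) (hi : i ∉ insert j S) (f : ℕ → ℝ) :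
    ∑ P : Finpartition (insert i (insert j S)),
      (f P.parts.card * ∏ A ∈ P.parts, egfCoeff A.card G) *
        ∑ A ∈ P.parts, (if i ∈ A ∧ j ∈ A then 1 else 0) =
      egfCoeff S.card (d⁄dX ℝ (d⁄dX ℝ G) * (d⁄dX ℝ (mk fun k => f k / (k ! : ℝ))).subst G) := by
  have hder : d⁄dX ℝ (mk fun k => f k / (k ! : ℝ)) = mk fun k => f (k + 1) / (k ! : ℝ) := by
    ext k
    simp only [coeff_derivative, coeff_mk, Nat.factorial_succ]
    push_cast
    field_simp
  -- Here `U` is the block of `i` without `i`. Only those `U` containing `j` survive; removing both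
  -- marked elements from one block then differentiates `G` twice.
  have key : ∀ U ∈ (insert j S).powerset, ∑ Q : Finpartition (insert j S \ U),
      (f (insert (insert i U) Q.parts).card *
        ∏ A ∈ insert (insert i U) Q.parts, egfCoeff A.card G) *
        ∑ A ∈ insert (insert i U) Q.parts, (if i ∈ A ∧ j ∈ A then (1 : ℝ) else 0) =
      if j ∈ U then egfCoeff (U.card + 1) G * egfCoeff (insert j S \ U).card
        ((d⁄dX ℝ (mk fun k => f k / (k ! : ℝ))).subst G) else 0 := by
    intro U hU
    have hUS := Finset.mem_powerset.1 hU
    have hji : j ≠ i := fun h => hi (h ▸ Finset.mem_insert_self j S)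
    have hiQ : ∀ Q : Finpartition (insert j S \ U), ∀ A ∈ Q.parts, i ∉ A := fun Q A hA h =>
      hi (Finset.mem_sdiff.1 (Q.le hA h)).1
    have hnot : ∀ Q : Finpartition (insert j S \ U), insert i U ∉ Q.parts := fun Q h =>
      hiQ Q _ h (Finset.mem_insert_self i U)
    have hcount : ∀ Q : Finpartition (insert j S \ U), ∑ A ∈ insert (insert i U) Q.parts,
        (if i ∈ A ∧ j ∈ A then (1 : ℝ) else 0) = if j ∈ U then 1 else 0 := by
      intro Q
      rw [Finset.sum_insert (hnot Q), Finset.sum_eq_zero fun A hA => if_neg fun h =>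
        hiQ Q A hA h.1]
      simp [hji]
    simp only [hcount]
    split_ifs with hjU
    · rw [hder, ← sum_finpartition_eq_egfCoeff_subst hG _ (fun k => f (k + 1)), Finset.mul_sum]
      refine Finset.sum_congr rfl fun Q _ => ?_
      rw [Finset.card_insert_of_notMem (hnot Q), Finset.prod_insert (hnot Q),
        Finset.card_insert_of_notMem fun h => hi (hUS h)]
      ring
    · simp
  rw [sum_finpartition_insert hi (fun p => (f p.card * ∏ A ∈ p, egfCoeff A.card G) *
    ∑ A ∈ p, (if i ∈ A ∧ j ∈ A then (1 : ℝ) else 0)), Finset.sum_congr rfl key,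
    Finset.sum_powerset_insert hj, Finset.sum_eq_zero, zero_add, ← sum_powerset_egfCoeff_mul]
  · refine Finset.sum_congr rfl fun V hV => ?_
    have hVS := Finset.mem_powerset.1 hV
    rw [if_pos (Finset.mem_insert_self j V), Finset.card_insert_of_notMem fun h => hj (hVS h),
      egfCoeff_succ, egfCoeff_succ, Finset.insert_sdiff_insert,
      Finset.sdiff_insert_of_notMem hj]
  · intro V hV
    exact if_neg fun h => hj (Finset.mem_powerset.1 hV h)

end Partitions

/-! ### Generating functions of the couplings. -/

theorem coeff_derivative_diffeo (a : ℕ → ℝ) (k : ℕ) :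
    coeff k (d⁄dX ℝ (diffeo a)) = ((k : ℝ) + 1) * a k := by
  rw [coeff_derivative, diffeo, coeff_succ_X_mul, coeff_mk, mul_comm]

/-- A vertex with `k` lower edges has degree `k + 1`, hence coupling index `k - 1`. The spurious
value at `k = 0` is a constant term, which the derivative removes. -/
theorem derivative_mk_kineticCoeff (a : ℕ → ℝ) :
    d⁄dX ℝ (mk fun k => kineticCoeff a (k - 1) / (k ! : ℝ)) = d⁄dX ℝ (diffeo a) ^ 2 := by
  ext k
  have h : coeff k (d⁄dX ℝ (mk fun k => kineticCoeff a (k - 1) / (k ! : ℝ))) =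
      kineticCoeff a k / (k ! : ℝ) := by
    simp only [coeff_derivative, coeff_mk, Nat.factorial_succ, Nat.add_sub_cancel]
    push_cast
    field_simp
  rw [h, sq, coeff_mul, Finset.Nat.sum_antidiagonal_eq_sum_range_succ
    (fun i j => coeff i (d⁄dX ℝ (diffeo a)) * coeff j (d⁄dX ℝ (diffeo a))), kineticCoeff,
    mul_div_cancel_left₀ _ (by positivity)]
  refine Finset.sum_congr rfl fun j hj => ?_
  rw [coeff_derivative_diffeo, coeff_derivative_diffeo,
    Nat.cast_sub (Nat.lt_succ_iff.1 (Finset.mem_range.1 hj))]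
  ring

/-- The convolution of `a` with itself is the coefficient of `t ^ (k + 2)` in `F²`, so both sides
are `-m² / 2` times the second derivative of `F²`. -/
theorem derivative_mk_massCoeff (a : ℕ → ℝ) (m : ℝ) :
    d⁄dX ℝ (mk fun k => massCoeff a m (k - 1) / (k ! : ℝ)) =
      C (-m ^ 2) * d⁄dX ℝ (diffeo a * d⁄dX ℝ (diffeo a)) := by
  ext k
  have h : coeff k (d⁄dX ℝ (mk fun k => massCoeff a m (k - 1) / (k ! : ℝ))) =
      massCoeff a m k / (k ! : ℝ) := by
    simp only [coeff_derivative, coeff_mk, Nat.factorial_succ, Nat.add_sub_cancel]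
    push_cast
    field_simp
  have hsq : d⁄dX ℝ (diffeo a ^ 2) = C 2 * (diffeo a * d⁄dX ℝ (diffeo a)) := by
    have : (C 2 : ℝ⟦X⟧) = 2 := map_ofNat C 2
    rw [derivative_pow, this]
    push_cast
    ring
  have h2 : 2 * coeff (k + 1) (diffeo a * d⁄dX ℝ (diffeo a)) =
      ((k : ℝ) + 2) * ∑ j ∈ Finset.range (k + 1), a j * a (k - j) := by
    have := congrArg (coeff (k + 1)) hsq
    rw [coeff_C_mul, coeff_derivative, diffeo, mul_pow, show k + 1 + 1 = k + 2 from rfl,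
      coeff_X_pow_mul, sq (mk a : ℝ⟦X⟧), coeff_mul,
      Finset.Nat.sum_antidiagonal_eq_sum_range_succ
        (fun i j => coeff i (mk a : ℝ⟦X⟧) * coeff j (mk a : ℝ⟦X⟧))] at this
    simp only [coeff_mk] at this
    rw [diffeo, ← this]
    push_cast
    ring
  rw [h, coeff_C_mul, coeff_derivative, massCoeff, Nat.factorial_succ, Nat.factorial_succ]
  push_cast
  have hk : (k ! : ℝ) ≠ 0 := by positivity
  rw [div_eq_iff hk]
  linear_combination (((k : ℝ) + 1) * m ^ 2 * (k ! : ℝ) / 2) * h2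

section Sums

variable {a : ℕ → ℝ} {G : ℝ⟦X⟧}

/-- By the chain rule the left side is `F'(G)² G'`, and `F'(G) G' = 1`. -/
theorem derivative_kinetic_subst (hG : constantCoeff G = 0) (h : (diffeo a).subst G = X) :
    d⁄dX ℝ ((mk fun k => kineticCoeff a (k - 1) / (k ! : ℝ)).subst G) = derivAlong a G := by
  have hs : HasSubst G := HasSubst.of_constantCoeff_zero' hG
  rw [derivative_subst hs, derivative_mk_kineticCoeff, subst_pow hs, ← derivAlong]
  linear_combination derivAlong a G * derivAlong_mul_derivative hs h

/-- Differentiate `F'(G) G' = 1` and multiply by `F'(G)`. The resulting sign drives the cancellation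
of the momentum products. -/
theorem second_derivative_mul_kinetic_subst (hG : constantCoeff G = 0)
    (h : (diffeo a).subst G = X) :
    d⁄dX ℝ (d⁄dX ℝ G) * (d⁄dX ℝ (mk fun k => kineticCoeff a (k - 1) / (k ! : ℝ))).subst G =
      -d⁄dX ℝ (derivAlong a G) := by
  have hs : HasSubst G := HasSubst.of_constantCoeff_zero' hG
  have h1 := derivAlong_mul_derivative hs h
  have h2 := congrArg (d⁄dX ℝ) h1
  rw [Derivation.leibniz, derivative_one, smul_eq_mul, smul_eq_mul] at h2
  rw [derivative_mk_kineticCoeff, subst_pow hs, ← derivAlong]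
  linear_combination derivAlong a G * h2 - d⁄dX ℝ (derivAlong a G) * h1

theorem derivative_mass_subst (m : ℝ) (hG : constantCoeff G = 0) (h : (diffeo a).subst G = X) :
    d⁄dX ℝ ((mk fun k => massCoeff a m (k - 1) / (k ! : ℝ)).subst G) =
      C (-m ^ 2) * d⁄dX ℝ (X * derivAlong a G) := by
  have hs : HasSubst G := HasSubst.of_constantCoeff_zero' hG
  have hc : (C (-m ^ 2) : ℝ⟦X⟧).subst G = (C (-m ^ 2) : ℝ⟦X⟧) := subst_C _
  have hx : X * derivAlong a G = (diffeo a * d⁄dX ℝ (diffeo a)).subst G := by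
    rw [subst_mul hs, h, derivAlong]
  rw [derivative_subst hs, derivative_mk_massCoeff, subst_mul hs, hc, hx, derivative_subst hs,
    mul_assoc]

variable {ι : Type*} [DecidableEq ι]

theorem sum_kineticCoeff (hG : constantCoeff G = 0) (h : (diffeo a).subst G = X)
    {S : Finset ι} {n : ℕ} (hS : S.card = n + 1) :
    ∑ P : Finpartition S, kineticCoeff a (P.parts.card - 1) * ∏ A ∈ P.parts, egfCoeff A.card G =
      egfCoeff n (derivAlong a G) := by
  rw [sum_finpartition_eq_egfCoeff_subst hG S (fun k => kineticCoeff a (k - 1)), hS, egfCoeff_succ,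
    derivative_kinetic_subst hG h]

theorem sum_massCoeff (m : ℝ) (hG : constantCoeff G = 0) (h : (diffeo a).subst G = X)
    {S : Finset ι} {n : ℕ} (hS : S.card = n + 1) :
    ∑ P : Finpartition S, massCoeff a m (P.parts.card - 1) * ∏ A ∈ P.parts, egfCoeff A.card G =
      -m ^ 2 * (S.card * egfCoeff n (derivAlong a G)) := by
  rw [sum_finpartition_eq_egfCoeff_subst hG S (fun k => massCoeff a m (k - 1)), hS, egfCoeff_succ,
    derivative_mass_subst m hG h]
  have := egfCoeff_X_mul n (derivAlong a G)
  rw [egfCoeff_succ] at this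
  push_cast
  rw [← this]
  simp only [egfCoeff, coeff_C_mul]
  ring

theorem sum_kineticCoeff_same_block (hG : constantCoeff G = 0) (h : (diffeo a).subst G = X)
    {S : Finset ι} {n : ℕ} (hS : S.card = n + 1) {i j : ι} (hi : i ∈ S) (hj : j ∈ S) :
    ∑ P : Finpartition S,
      (kineticCoeff a (P.parts.card - 1) * ∏ A ∈ P.parts, egfCoeff A.card G) *
        ∑ A ∈ P.parts, (if i ∈ A ∧ j ∈ A then 1 else 0) =
      if i = j then egfCoeff n (derivAlong a G) else -egfCoeff n (derivAlong a G) := by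
  split_ifs with hij
  · subst hij
    rw [← sum_kineticCoeff hG h hS]
    refine Finset.sum_congr rfl fun P _ => ?_
    have hcount : ∑ A ∈ P.parts, (if i ∈ A ∧ i ∈ A then (1 : ℝ) else 0) = 1 := by
      rw [Finset.sum_eq_single_of_mem (P.part i) (P.part_mem.2 hi)]
      · simp [P.mem_part_self.2 hi]
      · intro A hA hne
        refine if_neg fun h => hne (P.part_eq_of_mem hA h.1).symm
    rw [hcount, mul_one]
  · obtain ⟨T, hjT, hiT, rfl⟩ : ∃ T : Finset ι, j ∉ T ∧ i ∉ insert j T ∧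
        S = insert i (insert j T) := by
      refine ⟨(S.erase i).erase j, Finset.notMem_erase _ _, ?_, ?_⟩
      · simp [hij]
      · rw [Finset.insert_erase (Finset.mem_erase.2 ⟨Ne.symm hij, hj⟩), Finset.insert_erase hi]
    rw [Finset.card_insert_of_notMem hiT, Finset.card_insert_of_notMem hjT] at hS
    obtain rfl : n = T.card + 1 := by omega
    -- Two elements were removed from `S`, but the series is itself a derivative, which raises the
    -- index back to `n`.
    rw [sum_finpartition_same_block hG hjT hiT (fun k => kineticCoeff a (k - 1)),
      second_derivative_mul_kinetic_subst hG h, egfCoeff_succ]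
    simp [egfCoeff]

end Sums

/-! ### Momenta and the cancellation of vertex factors. -/

/-- The Minkowski inner product. -/
def minkowskiInner (p q : Momentum) : ℝ := p 0 * q 0 - ∑ k : Fin 3, p k.succ * q k.succ

theorem minkowskiInner_self (p : Momentum) : minkowskiInner p p = minkowskiSq p := by
  simp only [minkowskiInner, minkowskiSq, sq]

theorem minkowskiSq_edgeMomentum {ι : Type} (p : ι → Momentum) (S : Finset ι) :
    minkowskiSq (edgeMomentum p S) = ∑ i ∈ S, ∑ j ∈ S, minkowskiInner (p i) (p j) := by
  simp only [minkowskiSq, minkowskiInner, edgeMomentum, Finset.sum_apply, Finset.sum_sub_distrib,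
    sq, Finset.sum_mul_sum]
  congr 1
  rw [Finset.sum_comm]
  exact Finset.sum_congr rfl fun i _ => Finset.sum_comm

/-- Isolates the coefficient of each `p_i · p_j`, the number of blocks containing both legs, so that
the sum over partitions can be carried out for each pair separately. -/
theorem sum_minkowskiSq_parts {ι : Type} [DecidableEq ι] (p : ι → Momentum) {S : Finset ι}
    (P : Finpartition S) :
    ∑ A ∈ P.parts, minkowskiSq (edgeMomentum p A) =
      ∑ i ∈ S, ∑ j ∈ S, minkowskiInner (p i) (p j) *
        ∑ A ∈ P.parts, (if i ∈ A ∧ j ∈ A then 1 else 0) := by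
  have h : ∀ A ∈ P.parts, minkowskiSq (edgeMomentum p A) =
      ∑ i ∈ S, ∑ j ∈ S, minkowskiInner (p i) (p j) * (if i ∈ A ∧ j ∈ A then 1 else 0) := by
    intro A hA
    have hAS : S.filter (· ∈ A) = A := by
      rw [Finset.filter_mem_eq_inter, Finset.inter_eq_right.2 (P.le hA)]
    have hsum : ∀ g : ι → ℝ, ∑ i ∈ A, g i = ∑ i ∈ S, if i ∈ A then g i else 0 := fun g => by
      rw [← Finset.sum_filter, hAS]
    rw [minkowskiSq_edgeMomentum, hsum]
    refine Finset.sum_congr rfl fun i _ => ?_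
    rw [hsum]
    split_ifs with hi <;> simp [hi]
  rw [Finset.sum_congr rfl h, Finset.sum_comm]
  refine Finset.sum_congr rfl fun i _ => ?_
  rw [Finset.sum_comm]
  exact Finset.sum_congr rfl fun j _ => (Finset.mul_sum _ _ _).symm

variable {ι : Type} [DecidableEq ι]

/-- Summed over all partitions of the external legs, including the one with a single block, the
vertex factors cancel if all external momenta are on the mass shell. -/
theorem sum_vertex_eq_zero {a : ℕ → ℝ} {G : ℝ⟦X⟧} (hG : constantCoeff G = 0)
    (h : (diffeo a).subst G = X) {m : ℝ} {p : ι → Momentum}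
    (hp : ∀ i, minkowskiSq (p i) = m ^ 2) {S : Finset ι} (hS : S.Nonempty) :
    ∑ P : Finpartition S,
      (kineticCoeff a (P.parts.card - 1) / 2 * (minkowskiSq (edgeMomentum p S) +
        ∑ A ∈ P.parts, minkowskiSq (edgeMomentum p A)) + massCoeff a m (P.parts.card - 1)) *
        ∏ A ∈ P.parts, egfCoeff A.card G = 0 := by
  obtain ⟨n, hn⟩ : ∃ n, S.card = n + 1 := ⟨S.card - 1, by have := hS.card_pos; omega⟩
  set W := egfCoeff n (derivAlong a G) with hW
  have h1 := sum_kineticCoeff hG h hn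
  have h2 := sum_massCoeff m hG h hn
  have h3 : ∑ P : Finpartition S, (kineticCoeff a (P.parts.card - 1) *
      ∏ A ∈ P.parts, egfCoeff A.card G) * ∑ A ∈ P.parts, minkowskiSq (edgeMomentum p A) =
      2 * m ^ 2 * S.card * W - minkowskiSq (edgeMomentum p S) * W := by
    simp only [sum_minkowskiSq_parts, Finset.mul_sum (s := S)]
    rw [Finset.sum_comm]
    have : ∀ i ∈ S, ∑ P : Finpartition S, ∑ j ∈ S, (kineticCoeff a (P.parts.card - 1) *
        ∏ A ∈ P.parts, egfCoeff A.card G) * (minkowskiInner (p i) (p j) *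
          ∑ A ∈ P.parts, (if i ∈ A ∧ j ∈ A then 1 else 0)) =
        2 * m ^ 2 * W - ∑ j ∈ S, minkowskiInner (p i) (p j) * W := by
      intro i hi
      rw [Finset.sum_comm]
      -- The diagonal value `m² W` is written as `2 m² W - m² W`, so that the subtracted terms run
      -- over all pairs and add up to the square of the total momentum.
      have hj : ∀ j ∈ S, ∑ P : Finpartition S, (kineticCoeff a (P.parts.card - 1) *
          ∏ A ∈ P.parts, egfCoeff A.card G) * (minkowskiInner (p i) (p j) *
            ∑ A ∈ P.parts, (if i ∈ A ∧ j ∈ A then 1 else 0)) =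
          (if i = j then 2 * m ^ 2 * W else 0) - minkowskiInner (p i) (p j) * W := by
        intro j hj
        have := sum_kineticCoeff_same_block hG h hn hi hj
        simp only [mul_left_comm _ (minkowskiInner (p i) (p j))]
        rw [← Finset.mul_sum, this, ← hW]
        split_ifs with hij
        · subst hij
          rw [minkowskiInner_self, hp]
          ring
        · ring
      rw [Finset.sum_congr rfl hj, Finset.sum_sub_distrib, Finset.sum_ite_eq, if_pos hi]
    rw [Finset.sum_congr rfl this, Finset.sum_sub_distrib, minkowskiSq_edgeMomentum,
      Finset.sum_const, nsmul_eq_mul]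
    simp only [Finset.sum_mul]
    ring
  have hsplit : ∀ P : Finpartition S,
      (kineticCoeff a (P.parts.card - 1) / 2 * (minkowskiSq (edgeMomentum p S) +
        ∑ A ∈ P.parts, minkowskiSq (edgeMomentum p A)) + massCoeff a m (P.parts.card - 1)) *
        ∏ A ∈ P.parts, egfCoeff A.card G =
      minkowskiSq (edgeMomentum p S) / 2 *
        (kineticCoeff a (P.parts.card - 1) * ∏ A ∈ P.parts, egfCoeff A.card G) +
      1 / 2 * ((kineticCoeff a (P.parts.card - 1) * ∏ A ∈ P.parts, egfCoeff A.card G) *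
        ∑ A ∈ P.parts, minkowskiSq (edgeMomentum p A)) +
      massCoeff a m (P.parts.card - 1) * ∏ A ∈ P.parts, egfCoeff A.card G := fun P => by ring
  simp only [hsplit, Finset.sum_add_distrib, ← Finset.mul_sum, h1, h2, h3]
  ring

/-- The contribution of the vertices with at least two lower edges is minus that of the partition
with a single block. -/
theorem sum_vertex_two_le {a : ℕ → ℝ} (ha : a 0 = 1) {G : ℝ⟦X⟧} (hG : constantCoeff G = 0)
    (h : (diffeo a).subst G = X) {m : ℝ} {p : ι → Momentum}
    (hp : ∀ i, minkowskiSq (p i) = m ^ 2) {S : Finset ι} (hS : S.Nonempty) :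
    ∑ P : {P : Finpartition S // 2 ≤ P.parts.card},
      (kineticCoeff a (P.1.parts.card - 1) / 2 * (minkowskiSq (edgeMomentum p S) +
        ∑ A ∈ P.1.parts, minkowskiSq (edgeMomentum p A)) + massCoeff a m (P.1.parts.card - 1)) *
        ∏ A ∈ P.1.parts, egfCoeff A.card G =
      -(minkowskiSq (edgeMomentum p S) - m ^ 2) * egfCoeff S.card G := by
  have hz := sum_vertex_eq_zero hG h hp hS
  set f : Finpartition S → ℝ := fun P =>
    (kineticCoeff a (P.parts.card - 1) / 2 * (minkowskiSq (edgeMomentum p S) +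
        ∑ A ∈ P.parts, minkowskiSq (edgeMomentum p A)) + massCoeff a m (P.parts.card - 1)) *
        ∏ A ∈ P.parts, egfCoeff A.card G
  -- For one block the couplings are `d_0 = 1` and `c_0 = -m²`, and both edges carry the same
  -- momentum `q`, giving `q² - m²`.
  have hsingle : ∑ P : Finpartition S with ¬ 2 ≤ P.parts.card, f P =
      (minkowskiSq (edgeMomentum p S) - m ^ 2) * egfCoeff S.card G := by
    rw [Finset.sum_eq_single_of_mem (Finpartition.indiscrete hS.ne_empty)]
    · simp only [f, Finpartition.indiscrete_parts, Finset.card_singleton, Finset.sum_singleton,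
        Finset.prod_singleton, kineticCoeff, massCoeff, Nat.sub_self, zero_add, Finset.sum_range_one,
        ha, Nat.factorial_zero, Nat.factorial_two]
      push_cast
      ring
    · simp
    · intro P hP hne
      refine absurd ?_ hne
      have h1 : P.parts.card ≤ 1 := by
        have := (Finset.mem_filter.1 hP).2
        omega
      have h2 := (P.parts_nonempty hS.ne_empty).card_pos
      obtain ⟨A, hA⟩ := Finset.card_eq_one.1 (le_antisymm h1 h2)
      ext1
      have := P.sup_parts
      rw [hA, Finset.sup_singleton, id] at this
      rw [hA, this, Finpartition.indiscrete_parts]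
  have hsub : ∑ P : {P : Finpartition S // 2 ≤ P.parts.card}, f P.1 =
      ∑ P : Finpartition S with 2 ≤ P.parts.card, f P :=
    (Finset.sum_subtype _ (by simp) f).symm
  have := Finset.sum_filter_add_sum_filter_not Finset.univ
    (fun P : Finpartition S => 2 ≤ P.parts.card) f
  change ∑ P : {P : Finpartition S // 2 ≤ P.parts.card}, f P.1 = _
  linarith

theorem propagator_mul_vertexFactor (a : ℕ → ℝ) (m : ℝ) (p : ι → Momentum) {S : Finset ι}
    (P : Finpartition S) :
    propagator m (edgeMomentum p S) *
      vertexFactor a m (edgeMomentum p S ::ₘ P.parts.val.map (edgeMomentum p)) =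
    ((-(minkowskiSq (edgeMomentum p S) - m ^ 2)⁻¹ *
      (kineticCoeff a (P.parts.card - 1) / 2 * (minkowskiSq (edgeMomentum p S) +
        ∑ A ∈ P.parts, minkowskiSq (edgeMomentum p A)) + massCoeff a m (P.parts.card - 1)) : ℝ) :
      ℂ) := by
  have hI := Complex.I_mul_I
  simp only [propagator, vertexFactor, kineticVertex, massVertex, Multiset.card_cons,
    Multiset.card_map, Finset.card_val, Multiset.map_cons, Multiset.sum_cons, Multiset.map_map,
    Function.comp_def, Finset.sum_map_val, Nat.reduceSubDiff]
  push_cast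
  rw [div_eq_mul_inv]
  linear_combination ((minkowskiSq (edgeMomentum p S) : ℂ) - (m : ℂ) ^ 2)⁻¹ *
    ((kineticCoeff a (P.parts.card - 1) : ℂ) / 2 * (minkowskiSq (edgeMomentum p S) +
        ∑ A ∈ P.parts, (minkowskiSq (edgeMomentum p A) : ℂ)) +
      massCoeff a m (P.parts.card - 1)) * hI

/-! ### The recursion over trees and its solution. -/

theorem Subtree.heq_leaf {S : Finset ι} (T : Subtree S) {i : ι} (h : S = {i}) :
    HEq T (Subtree.leaf i) := by
  cases T with
  | leaf j =>
    obtain rfl : j = i := by simpa using h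
    rfl
  | node P hP child =>
    subst h
    have := P.card_parts_le_card
    simp only [Finset.card_singleton] at this
    omega

theorem sum_weight_singleton (a : ℕ → ℝ) (m : ℝ) (p : ι → Momentum) (i : ι) :
    ∑ T : Subtree ({i} : Finset ι), T.weight a m p = 1 := by
  rw [Fintype.sum_eq_single (Subtree.leaf i) fun T hT => absurd (eq_of_heq (T.heq_leaf rfl)) hT,
    Subtree.weight]

/-- With two or more legs a tree is a top vertex together with an independent choice of subtree for
each block, so the sum of products factors. -/
theorem sum_weight_eq_sum_finpartition (a : ℕ → ℝ) (m : ℝ) (p : ι → Momentum) {S : Finset ι}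
    (hS : 2 ≤ S.card) :
    ∑ T : Subtree S, T.weight a m p =
      ∑ P : {P : Finpartition S // 2 ≤ P.parts.card},
        propagator m (edgeMomentum p S) *
          vertexFactor a m (edgeMomentum p S ::ₘ P.1.parts.val.map (edgeMomentum p)) *
          ∏ A : P.1.parts, ∑ T : Subtree (A : Finset ι), T.weight a m p := by
  let e : (Σ P : {P : Finpartition S // 2 ≤ P.parts.card},
      ∀ A : P.1.parts, Subtree (A : Finset ι)) → Subtree S :=
    fun x => Subtree.node x.1.1 x.1.2 x.2
  have he : Function.Bijective e := by
    constructor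
    · rintro ⟨⟨P, hP⟩, c⟩ ⟨⟨P', hP'⟩, c'⟩ h
      simp only [e, Subtree.node.injEq] at h
      obtain ⟨rfl, h⟩ := h
      rw [eq_of_heq h]
    · intro T
      cases T with
      | leaf i => simp at hS
      | node P hP child => exact ⟨⟨⟨P, hP⟩, child⟩, rfl⟩
  rw [← he.sum_comp, Fintype.sum_sigma]
  refine Finset.sum_congr rfl fun P _ => ?_
  rw [Finset.prod_univ_sum, Fintype.piFinset_univ, Finset.mul_sum]
  rfl

theorem sum_weight_eq_egfCoeff {a : ℕ → ℝ} (ha : a 0 = 1) {G : ℝ⟦X⟧} (hG : constantCoeff G = 0)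
    (h : (diffeo a).subst G = X) {m : ℝ} {p : ι → Momentum}
    (hp : ∀ i, minkowskiSq (p i) = m ^ 2)
    (hoff : ∀ S : Finset ι, 2 ≤ S.card → minkowskiSq (edgeMomentum p S) ≠ m ^ 2)
    {S : Finset ι} (hS : S.Nonempty) :
    ∑ T : Subtree S, T.weight a m p = (egfCoeff S.card G : ℂ) := by
  induction S using Finset.strongInduction with
  | H S ih =>
  rcases Nat.lt_or_ge S.card 2 with hlt | hge
  · obtain ⟨i, rfl⟩ := Finset.card_eq_one.1 (show S.card = 1 by have := hS.card_pos; omega)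
    -- For a single leg the value is `G'(0)`, which is `1` because `F'(0) G'(0) = 1` and `F'(0) = a
    -- 0 = 1`.
    have h1 := congrArg constantCoeff
      (derivAlong_mul_derivative (HasSubst.of_constantCoeff_zero' hG) h)
    rw [map_mul, derivAlong, constantCoeff_subst_of_constantCoeff_eq_zero hG, map_one,
      ← coeff_zero_eq_constantCoeff_apply, ← coeff_zero_eq_constantCoeff_apply,
      coeff_derivative_diffeo, coeff_derivative, ha] at h1
    rw [sum_weight_singleton, Finset.card_singleton]
    simp only [egfCoeff, Nat.factorial_one]
    norm_num at h1
    simp [h1]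
  · rw [sum_weight_eq_sum_finpartition a m p hge]
    have hne : minkowskiSq (edgeMomentum p S) - m ^ 2 ≠ 0 := sub_ne_zero.2 (hoff S hge)
    have hprod : ∀ P : {P : Finpartition S // 2 ≤ P.parts.card},
        ∏ A : P.1.parts, ∑ T : Subtree (A : Finset ι), T.weight a m p =
          ((∏ A ∈ P.1.parts, egfCoeff A.card G : ℝ) : ℂ) := by
      rintro ⟨P, hP⟩
      rw [Complex.ofReal_prod, ← Finset.prod_coe_sort P.parts fun A => (egfCoeff A.card G : ℂ)]
      refine Fintype.prod_congr _ _ fun A => ih A.1 ?_ (P.nonempty_of_mem_parts A.2)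
      refine (Finset.ssubset_iff_subset_ne).2 ⟨P.le A.2, fun hA => ?_⟩
      obtain ⟨B, hB, hBA⟩ := Finset.exists_mem_ne (s := P.parts) (by omega) A.1
      obtain ⟨x, hx⟩ := P.nonempty_of_mem_parts hB
      exact hBA (P.eq_of_mem_parts hB A.2 hx (hA.ge (P.le hB hx)))
    simp only [propagator_mul_vertexFactor, hprod]
    simp only [← Complex.ofReal_mul, ← Complex.ofReal_sum, mul_assoc, ← Finset.mul_sum]
    rw [sum_vertex_two_le ha hG h hp hS]
    congr 1
    field_simp

end FieldDiffeo

theorem mainTheorem1 (a : ℕ → ℝ) (ha : a 0 = 1) (n : ℕ) :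
    (∀ (m : ℝ) (p : Fin (n + 1) → FieldDiffeo.Momentum), FieldDiffeo.IsAdmissible m p →
      FieldDiffeo.b a m p =
        ((∑ k ∈ Finset.range (n + 1), ((n + k).factorial : ℝ) / (n.factorial : ℝ) *
          FieldDiffeo.bell n k (fun j => -(j.factorial : ℝ) * a j) : ℝ) : ℂ)) ∧
    (∀ (m m' : ℝ) (p p' : Fin (n + 1) → FieldDiffeo.Momentum),
      FieldDiffeo.IsAdmissible m p → FieldDiffeo.IsAdmissible m' p' →
        FieldDiffeo.b a m p = FieldDiffeo.b a m' p') := by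
  have main : ∀ (m : ℝ) (p : Fin (n + 1) → FieldDiffeo.Momentum), FieldDiffeo.IsAdmissible m p →
      FieldDiffeo.b a m p =
        ((∑ k ∈ Finset.range (n + 1), ((n + k).factorial : ℝ) / (n.factorial : ℝ) *
          FieldDiffeo.bell n k (fun j => -(j.factorial : ℝ) * a j) : ℝ) : ℂ) := by
    intro m p hp
    -- The linear coefficient of `F` is a unit, so `F` has a two-sided formal inverse `G`. The tree
    -- sums use `F(G) = t`, Lagrange inversion uses `G(F) = t`.
    have hu := FieldDiffeo.isUnit_coeff_one_diffeo ha
    have h0 := FieldDiffeo.constantCoeff_diffeo a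
    rw [FieldDiffeo.b, FieldDiffeo.sum_weight_eq_egfCoeff ha
      (PowerSeries.constantCoeff_substInvOfIsUnit (FieldDiffeo.diffeo a) hu)
      (PowerSeries.subst_substInvOfIsUnit_right (FieldDiffeo.diffeo a) h0 hu)
      hp.onShell hp.offShell Finset.univ_nonempty, Finset.card_univ, Fintype.card_fin,
      FieldDiffeo.egfCoeff_inverse_eq_sum_bell ha
        (PowerSeries.subst_substInvOfIsUnit_left (FieldDiffeo.diffeo a) h0 hu)]
  exact ⟨main, fun m m' p p' hp hp' => (main m p hp).trans (main m' p' hp').symm⟩
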